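/- Let $n\ge 1$ and $[n]=\{1,\dots,n\}$, and let $[n]'=\{1',\dots,n'\}$ be a disjoint copy of $[n]$. The partition monoid $\mathcal P_n$ consists of all equivalence relations on $[n]\cup[n]'$; the product $\alpha\beta$ is obtained by stacking $\alpha$ above $\beta$, identifying the lower row of $\alpha$ with the upper row of $\beta$, taking connected components, and deleting the middle row. The Brauer monoid $\mathcal B_n$ is the submonoid of all $\alpha\in\mathcal P_n$ all of whose blocks have exactly two elements. The rank of $\alpha$ is the number of its blocks that meet both $[n]$ and $[n]'$, and $J_r(\mathcal B_n)=\{\alpha\in\mathcal B_n:\operatorname{rank}(\alpha)=r\}$; for $0\le r\le n$ with $r\equiv n \pmod 2$, these sets are exactly the $\mathscr J$-classes of $\mathcal B_n$. The (undirected) Graham--Houghton graph of a $\mathscr J$-class $J$ of a finite regular monoid $M$ is the bipartite graph whose two parts are the set of $\mathscr R$-classes and the set of $\mathscr L$-classes contained in $J$ (where $u\,\mathscr R\,v\Leftrightarrow uM=vM$ and $u\,\mathscr L\,v\Leftrightarrow Mu=Mv$), an $\mathscr R$-class $R$ and an $\mathscr L$-class $L$ being adjacent if and only if $R\cap L$ contains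 an idempotent. An orientation $D$ of a finite simple graph $G$ chooses one of the two directions for each edge. A circuit $C$ (closed path without repeated vertices) of $G$ is central if the graph obtained from $G$ by deleting all vertices of $C$ has a perfect matching (the empty graph has one). A circuit of even length is oddly oriented in $D$ if, for either choice of direction of traversal, the number of its edges that $D$ directs in the direction of traversal is odd. The orientation $D$ is Pfaffian if every central circuit of even length in $G$ is oddly oriented in $D$. **Proposition.** Let $n\ge 3$, and let $\Delta_n$ be the undirected Graham--Houghton graph of the $\mathscr J$-class $J_{n-2}(\mathcal B_n)$ of the Brauer monoid $\mathcal B_n$. Then $\Delta_n$ does not admit a Pfaffian orientation. -/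

import Mathlib

namespace DiagramMonoid

/-! ### The partition monoid and the Brauer monoid -/

/-- An `n`-partition: an equivalence relation on `[n] ∪ [n]'`. The points `Sum.inl i` form the
upper row `[n]`, the points `Sum.inr i` form the lower row `[n]'`. -/
@[ext]
structure PartitionMonoid (n : ℕ) where
  /-- The underlying equivalence relation. -/
  toSetoid : Setoid (Fin n ⊕ Fin n)

variable {n : ℕ}

/-- Embedding of the two rows of a diagram as the upper and middle of three rows. -/
def topMid : Fin n ⊕ Fin n → Fin n ⊕ (Fin n ⊕ Fin n) := Sum.map id Sum.inl

/-- Embedding of the two rows of a diagram as the middle and lower of three rows. -/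
def midBot : Fin n ⊕ Fin n → Fin n ⊕ (Fin n ⊕ Fin n) := Sum.inr

/-- Embedding of the two rows of a diagram as the upper and lower of three rows. -/
def topBot : Fin n ⊕ Fin n → Fin n ⊕ (Fin n ⊕ Fin n) := Sum.map id Sum.inr

/-- The product of `α` and `β`: stack `α` on top of `β`, identifying the lower row of `α` with the
upper row of `β`, take the connected components, and forget the middle row. -/
def PartitionMonoid.mul (α β : PartitionMonoid n) : PartitionMonoid n where
  toSetoid := Setoid.comap topBot (Setoid.map α.toSetoid topMid ⊔ Setoid.map β.toSetoid midBot)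

/-- The identity partition, with blocks `{i, i'}`. -/
def PartitionMonoid.one (n : ℕ) : PartitionMonoid n where
  toSetoid := Setoid.ker (Sum.elim id id)

section aux

variable {A B C X : Type*}

theorem map_le_iff {r : Setoid A} {f : A → B} {s : Setoid B} :
    Setoid.map r f ≤ s ↔ r ≤ Setoid.comap f s := by
  constructor
  · intro h x y hxy
    exact h (Setoid.le_comap_map hxy)
  · intro h
    refine Setoid.eqvGen_le ?_
    rintro _ _ ⟨a, b, hab, rfl, rfl⟩
    exact h hab

theorem map_sup (r s : Setoid A) (f : A → B) :
    Setoid.map (r ⊔ s) f = Setoid.map r f ⊔ Setoid.map s f := by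
  refine eq_of_forall_ge_iff fun t => ?_
  have h : ∀ u : Setoid A, u ≤ Setoid.comap f t ↔ Setoid.map u f ≤ t := fun u => map_le_iff.symm
  rw [sup_le_iff, ← h, ← h, ← h, sup_le_iff]

theorem map_map (r : Setoid A) (f : A → B) (g : B → C) :
    Setoid.map (Setoid.map r f) g = Setoid.map r (g ∘ f) := by
  refine eq_of_forall_ge_iff fun t => ?_
  rw [map_le_iff, map_le_iff, map_le_iff, Setoid.comap_comp]

theorem map_apply (r : Setoid A) {f : A → B} (hf : Function.Injective f) (x y : B) :
    Setoid.map r f x y ↔ (∃ a b, r a b ∧ f a = x ∧ f b = y) ∨ x = y := by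
  have h := Setoid.coe_map_of_ker_le r f (by
    intro a b hab
    rw [hf hab])
  rw [h]
  rfl

theorem comap_sup_map (f : B → X) (R : Setoid X) (S : Setoid B) :
    Setoid.comap f (R ⊔ Setoid.map S f) = Setoid.comap f R ⊔ S := by
  apply le_antisymm
  · set E : Setoid B := Setoid.comap f R ⊔ S with hE
    have h1 : ∀ a b, R (f a) (f b) → E a b := fun a b h =>
      (le_sup_left : Setoid.comap f R ≤ E) h
    let F : Setoid X :=
      { r := fun x y => R x y ∨ ∃ a b, R x (f a) ∧ E a b ∧ R (f b) y
        iseqv :=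
          { refl := fun x => Or.inl (R.refl x)
            symm := by
              rintro x y (h | ⟨a, b, h, h', h''⟩)
              · exact Or.inl (R.symm h)
              · exact Or.inr ⟨b, a, R.symm h'', E.symm h', R.symm h⟩
            trans := by
              rintro x y z (h | ⟨a, b, h, h', h''⟩) (k | ⟨c, d, k, k', k''⟩)
              · exact Or.inl (R.trans h k)
              · exact Or.inr ⟨c, d, R.trans h k, k', k''⟩
              · exact Or.inr ⟨a, b, h, h', R.trans h'' k⟩
              · exact Or.inr ⟨a, d, h, E.trans h' (E.trans (h1 _ _ (R.trans h'' k)) k'), k''⟩ } }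
    have hF : R ⊔ Setoid.map S f ≤ F := by
      refine sup_le (fun {x y} h => Or.inl h) (map_le_iff.2 ?_)
      intro a b h
      exact Or.inr ⟨a, b, R.refl _, (le_sup_right : S ≤ E) h, R.refl _⟩
    intro a b h
    rcases hF h with h | ⟨c, d, h, h', h''⟩
    · exact h1 _ _ h
    · exact E.trans (h1 _ _ h) (E.trans h' (h1 _ _ h''))
  · refine sup_le ?_ (map_le_iff.1 le_sup_right)
    intro a b h
    exact (le_sup_left : R ≤ R ⊔ Setoid.map S f) h

theorem map_comap_square {f : B → X} {g : C → X} {t : A → B} {s : A → C} (W : Setoid C)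
    (hg : Function.Injective g) (ht : Function.Injective t) (hf : Function.Injective f)
    (hsq : ∀ z, f (t z) = g (s z)) (hpb : ∀ x y, f x = g y → ∃ z, x = t z ∧ y = s z) :
    Setoid.map (Setoid.comap s W) t = Setoid.comap f (Setoid.map W g) := by
  ext x y
  rw [Setoid.comap_rel, map_apply _ ht, map_apply _ hg, hf.eq_iff]
  constructor
  · rintro (⟨a, b, h, rfl, rfl⟩ | h)
    · exact Or.inl ⟨s a, s b, h, (hsq a).symm, (hsq b).symm⟩
    · exact Or.inr h
  · rintro (⟨a, b, h, ha, hb⟩ | h)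
    · obtain ⟨z, rfl, rfl⟩ := hpb _ _ ha.symm
      obtain ⟨w, rfl, rfl⟩ := hpb _ _ hb.symm
      exact Or.inl ⟨z, w, h, rfl, rfl⟩
    · exact Or.inr h

/-- In a finite set with two involutions `a`, `b` without common fixed points, the component of a
fixed point of `b` contains exactly one other point fixed by `a` or `b`. -/
theorem dihedral_orbit [Finite X] (a b : Equiv.Perm X) (ha : a * a = 1) (hb : b * b = 1)
    (E : Setoid X) (hEa : ∀ x, E x (a x)) (hEb : ∀ x, E x (b x))
    (hE : ∀ T : Setoid X, (∀ x, T x (a x)) → (∀ x, T x (b x)) → E ≤ T)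
    (hab : ∀ x, ¬ (a x = x ∧ b x = x)) (x : X) (hx : b x = x) :
    ∃ z, z ≠ x ∧ (a z = z ∨ b z = z) ∧ E x z ∧
      ∀ w, E x w → (a w = w ∨ b w = w) → w = x ∨ w = z := by
  set c : Equiv.Perm X := a * b with hc
  have ha' : a⁻¹ = a := inv_eq_of_mul_eq_one_left ha
  have hb' : b⁻¹ = b := inv_eq_of_mul_eq_one_left hb
  have hbc : ∀ k : ℤ, b * c ^ k = c ^ (-k) * b := by
    intro k
    have h1 : b * c * b⁻¹ = c⁻¹ := by
      rw [hc, mul_inv_rev, ha', hb', mul_assoc, mul_assoc, hb, mul_one]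
    have h2 := conj_zpow (a := b) (b := c) (i := k)
    rw [h1, inv_zpow'] at h2
    rw [h2, inv_mul_cancel_right]
  have hac : ∀ k : ℤ, a * c ^ k = c ^ (1 - k) * b := by
    intro k
    have h1 : a = c * b := by rw [hc, mul_assoc, hb, mul_one]
    calc a * c ^ k = c * (b * c ^ k) := by rw [← mul_assoc, ← h1]
      _ = c ^ (1 - k) * b := by rw [hbc, ← mul_assoc, ← zpow_one_add, sub_eq_add_neg]
  have hb_pow : ∀ k : ℤ, b ((c ^ k) x) = (c ^ (-k)) x := by
    intro k
    have := congrArg (fun p : Equiv.Perm X => p x) (hbc k)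
    simpa [hx] using this
  have ha_pow : ∀ k : ℤ, a ((c ^ k) x) = (c ^ (1 - k)) x := by
    intro k
    have := congrArg (fun p : Equiv.Perm X => p x) (hac k)
    simpa only [Equiv.Perm.mul_apply, hx] using this
  have hEc : ∀ y, E y (c y) := fun y => E.trans (hEb y) (hEa (b y))
  have hEpow : ∀ k : ℤ, E x ((c ^ k) x) := by
    have hnat : ∀ (m : ℕ) (y : X), E y ((c ^ m) y) := by
      intro m
      induction m with
      | zero => intro y; exact E.refl y
      | succ m ih =>
        intro y
        rw [pow_succ', Equiv.Perm.mul_apply]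
        exact E.trans (ih y) (hEc _)
    intro k
    obtain ⟨m, rfl | rfl⟩ := k.eq_nat_or_neg
    · rw [zpow_natCast]; exact hnat m x
    · have := hnat m ((c ^ (-(m : ℤ))) x)
      rw [← zpow_natCast, ← Equiv.Perm.mul_apply, ← zpow_add] at this
      simp only [add_neg_cancel, zpow_zero, Equiv.Perm.one_apply] at this
      exact E.symm this
  have hEorb : ∀ w, E x w → ∃ k : ℤ, w = (c ^ k) x := by
    let T : Setoid X := Setoid.ker (fun y => ∃ k : ℤ, y = (c ^ k) x)
    have hT : E ≤ T := by
      refine hE T (fun y => ?_) (fun y => ?_)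
      · refine propext ⟨?_, ?_⟩
        · rintro ⟨k, rfl⟩; exact ⟨1 - k, ha_pow k⟩
        · rintro ⟨k, hk⟩
          refine ⟨1 - k, ?_⟩
          rw [← ha_pow, ← hk, ← Equiv.Perm.mul_apply, ha, Equiv.Perm.one_apply]
      · refine propext ⟨?_, ?_⟩
        · rintro ⟨k, rfl⟩; exact ⟨-k, hb_pow k⟩
        · rintro ⟨k, hk⟩
          refine ⟨-k, ?_⟩
          rw [← hb_pow, ← hk, ← Equiv.Perm.mul_apply, hb, Equiv.Perm.one_apply]
    intro w hw
    have h : (∃ k : ℤ, x = (c ^ k) x) = (∃ k : ℤ, w = (c ^ k) x) := hT hw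
    rw [← h]
    exact ⟨0, rfl⟩
  have hax : a x ≠ x := fun h => hab x ⟨h, hx⟩
  obtain ⟨N, hN0, hN⟩ : ∃ N : ℕ, 0 < N ∧ ∀ k : ℤ, (c ^ k) x = x ↔ (N : ℤ) ∣ k := by
    refine ⟨Function.minimalPeriod (c • ·) x, ?_, fun k => ?_⟩
    · apply Function.minimalPeriod_pos_of_mem_periodicPts
      exact Function.Injective.mem_periodicPts (MulAction.injective c) x
    · exact MulAction.zpow_smul_eq_iff_minimalPeriod_dvd (a := c) (b := x) (n := k)
  have hNeq : ∀ k l : ℤ, (c ^ k) x = (c ^ l) x ↔ (N : ℤ) ∣ k - l := by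
    intro k l
    rw [← hN, sub_eq_neg_add, zpow_add, Equiv.Perm.mul_apply, zpow_neg, Equiv.Perm.inv_eq_iff_eq]
  have hbfix : ∀ k : ℤ, b ((c ^ k) x) = (c ^ k) x ↔ (N : ℤ) ∣ 2 * k := by
    intro k
    rw [hb_pow, hNeq, ← dvd_neg]
    ring_nf
  have hafix : ∀ k : ℤ, a ((c ^ k) x) = (c ^ k) x ↔ (N : ℤ) ∣ 2 * k - 1 := by
    intro k
    rw [ha_pow, hNeq, ← dvd_neg]
    ring_nf
  have key : ∀ q : ℤ, ∀ w, E x w → (a w = w ∨ b w = w) →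
      ((N : ℤ) = 2 * q ∨ (N : ℤ) = 2 * q - 1) → w = x ∨ w = (c ^ q) x := by
    intro q w hw hfix hq
    obtain ⟨k, rfl⟩ := hEorb w hw
    have hx0 : (c ^ k) x = x ↔ (N : ℤ) ∣ k := hN k
    rw [hx0, hNeq]
    rw [hafix, hbfix] at hfix
    rcases hfix with ⟨d, hd⟩ | ⟨d, hd⟩
    · right
      rcases hq with hq | hq
      · exfalso
        rw [hq] at hd
        have : 2 * (k - q * d) = 1 := by linarith
        omega
      · have hodd : d % 2 = 1 := by
          rcases Int.emod_two_eq_zero_or_one d with h | h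
          · exfalso
            obtain ⟨e, rfl⟩ : ∃ e, d = 2 * e := ⟨d / 2, by omega⟩
            have : 2 * (k - (N : ℤ) * e) = 1 := by linarith
            omega
          · exact h
        obtain ⟨e, rfl⟩ : ∃ e, d = 2 * e + 1 := ⟨d / 2, by omega⟩
        exact ⟨e, by linarith⟩
    · rcases Int.emod_two_eq_zero_or_one d with h | h
      · obtain ⟨e, rfl⟩ : ∃ e, d = 2 * e := ⟨d / 2, by omega⟩
        exact Or.inl ⟨e, by linarith⟩
      · obtain ⟨e, rfl⟩ : ∃ e, d = 2 * e + 1 := ⟨d / 2, by omega⟩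
        rcases hq with hq | hq
        · exact Or.inr ⟨e, by linarith⟩
        · exfalso
          rw [hq] at hd
          have : 2 * (k - (2 * q - 1) * e - q) = -1 := by linarith
          omega
  rcases Nat.even_or_odd' N with ⟨q, hq | hq⟩
  · refine ⟨(c ^ (q : ℤ)) x, ?_, Or.inr ?_, hEpow _, fun w hw hfix =>
      key q w hw hfix (Or.inl (by omega))⟩
    · rw [Ne, hN]
      intro h
      have := Int.le_of_dvd (by omega) h
      omega
    · rw [hbfix]
      exact ⟨1, by omega⟩
  · refine ⟨(c ^ ((q : ℤ) + 1)) x, ?_, Or.inl ?_, hEpow _, fun w hw hfix =>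
      key (q + 1) w hw hfix (Or.inr (by omega))⟩
    · rw [Ne, hN]
      intro h
      have h1 := Int.le_of_dvd (by omega) h
      have hq0 : q = 0 := by omega
      subst hq0
      have h2 : (c ^ (1 : ℤ)) x = x := (hN 1).2 (by rw [hq]; simp)
      rw [zpow_one, hc, Equiv.Perm.mul_apply, hx] at h2
      exact hax h2
    · rw [hafix]
      exact ⟨1, by omega⟩

end aux

theorem topMid_injective : Function.Injective (topMid (n := n)) :=
  Sum.map_injective.2 ⟨Function.injective_id, Sum.inl_injective⟩

theorem midBot_injective : Function.Injective (midBot (n := n)) := Sum.inr_injective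

theorem topBot_injective : Function.Injective (topBot (n := n)) :=
  Sum.map_injective.2 ⟨Function.injective_id, Sum.inr_injective⟩

theorem PartitionMonoid.mul_assoc' (α β γ : PartitionMonoid n) :
    (α.mul β).mul γ = α.mul (β.mul γ) := by
  let f134 : Fin n ⊕ (Fin n ⊕ Fin n) → Fin n ⊕ (Fin n ⊕ (Fin n ⊕ Fin n)) := Sum.map id Sum.inr
  let f123 : Fin n ⊕ (Fin n ⊕ Fin n) → Fin n ⊕ (Fin n ⊕ (Fin n ⊕ Fin n)) := Sum.map id (Sum.map id Sum.inl)
  let f124 : Fin n ⊕ (Fin n ⊕ Fin n) → Fin n ⊕ (Fin n ⊕ (Fin n ⊕ Fin n)) := Sum.map id (Sum.map id Sum.inr)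
  let f234 : Fin n ⊕ (Fin n ⊕ Fin n) → Fin n ⊕ (Fin n ⊕ (Fin n ⊕ Fin n)) := Sum.inr
  have i134 : Function.Injective f134 :=
    Sum.map_injective.2 ⟨Function.injective_id, Sum.inr_injective⟩
  have i123 : Function.Injective f123 := Sum.map_injective.2 ⟨Function.injective_id,
    Sum.map_injective.2 ⟨Function.injective_id, Sum.inl_injective⟩⟩
  have i124 : Function.Injective f124 := Sum.map_injective.2 ⟨Function.injective_id,
    Sum.map_injective.2 ⟨Function.injective_id, Sum.inr_injective⟩⟩
  have i234 : Function.Injective f234 := Sum.inr_injective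
  have hL : ((α.mul β).mul γ).toSetoid = Setoid.comap (f134 ∘ topBot)
      (Setoid.map α.toSetoid (f123 ∘ topMid) ⊔ Setoid.map β.toSetoid (f123 ∘ midBot) ⊔
        Setoid.map γ.toSetoid (f134 ∘ midBot)) := by
    change Setoid.comap topBot (Setoid.map (Setoid.comap topBot
      (Setoid.map α.toSetoid topMid ⊔ Setoid.map β.toSetoid midBot)) topMid ⊔
        Setoid.map γ.toSetoid midBot) = _
    rw [map_comap_square (f := f134) (g := f123) _ i123 topMid_injective i134
      (by rintro (z | z) <;> rfl)
      (by
        rintro (x | x | x) (y | y | y) h <;>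
          simp only [f134, f123, Sum.map_inl, Sum.map_inr, Sum.inl.injEq, Sum.inr.injEq,
            reduceCtorEq, id_eq] at h
        · subst h; exact ⟨Sum.inl x, rfl, rfl⟩
        · subst h; exact ⟨Sum.inr x, rfl, rfl⟩),
      ← comap_sup_map, map_map, map_sup, map_map, map_map, Setoid.comap_comp]
  have hR : (α.mul (β.mul γ)).toSetoid = Setoid.comap (f124 ∘ topBot)
      (Setoid.map β.toSetoid (f234 ∘ topMid) ⊔ Setoid.map γ.toSetoid (f234 ∘ midBot) ⊔
        Setoid.map α.toSetoid (f124 ∘ topMid)) := by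
    change Setoid.comap topBot (Setoid.map α.toSetoid topMid ⊔ Setoid.map (Setoid.comap topBot
      (Setoid.map β.toSetoid topMid ⊔ Setoid.map γ.toSetoid midBot)) midBot) = _
    rw [map_comap_square (f := f124) (g := f234) _ i234 midBot_injective i124
      (by rintro (z | z) <;> rfl)
      (by
        rintro (x | x | x) (y | y | y) h <;>
          simp only [f124, f234, Sum.map_inl, Sum.map_inr, Sum.inl.injEq, Sum.inr.injEq,
            reduceCtorEq, id_eq] at h
        · subst h; exact ⟨Sum.inl x, rfl, rfl⟩
        · subst h; exact ⟨Sum.inr x, rfl, rfl⟩),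
      sup_comm, ← comap_sup_map, map_map, map_sup, map_map, map_map, Setoid.comap_comp]
  have e0 : f134 ∘ topBot = f124 ∘ topBot := by funext x; rcases x with x | x <;> rfl
  have e1 : f123 ∘ topMid = f124 ∘ topMid := by funext x; rcases x with x | x <;> rfl
  have e2 : f123 ∘ midBot = f234 ∘ topMid := by funext x; rcases x with x | x <;> rfl
  have e3 : f134 ∘ midBot = f234 ∘ midBot := by funext x; rcases x with x | x <;> rfl
  apply PartitionMonoid.ext
  rw [hL, hR, e0, e1, e2, e3, sup_assoc, sup_comm]

theorem PartitionMonoid.mul_one' (α : PartitionMonoid n) :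
    α.mul (PartitionMonoid.one n) = α := by
  apply PartitionMonoid.ext
  apply le_antisymm
  · let p : Fin n ⊕ (Fin n ⊕ Fin n) → Fin n ⊕ Fin n := Sum.map id (Sum.elim id id)
    have h : Setoid.map α.toSetoid topMid ⊔ Setoid.map (PartitionMonoid.one n).toSetoid midBot ≤
        Setoid.comap p α.toSetoid := by
      refine sup_le (map_le_iff.2 ?_) (map_le_iff.2 ?_)
      · rintro (x | x) (y | y) h <;> exact h
      · rintro (x | x) (y | y) h <;> (obtain rfl : x = y := h; exact Setoid.refl' _ _)
    rintro (x | x) (y | y) hxy <;> exact h hxy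
  · set E := Setoid.map α.toSetoid topMid ⊔ Setoid.map (PartitionMonoid.one n).toSetoid midBot with hE
    have h1 : ∀ x, E (topBot x) (topMid x) := by
      rintro (x | x)
      · exact E.refl _
      · exact (map_le_iff.1 (le_sup_right : _ ≤ E)) (x := Sum.inr x) (y := Sum.inl x) rfl
    intro x y h
    exact E.trans (h1 x) (E.trans ((map_le_iff.1 (le_sup_left : _ ≤ E)) h) (E.symm (h1 y)))

theorem PartitionMonoid.one_mul' (α : PartitionMonoid n) :
    (PartitionMonoid.one n).mul α = α := by
  apply PartitionMonoid.ext
  apply le_antisymm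
  · let p : Fin n ⊕ (Fin n ⊕ Fin n) → Fin n ⊕ Fin n := Sum.elim Sum.inl id
    have h : Setoid.map (PartitionMonoid.one n).toSetoid topMid ⊔ Setoid.map α.toSetoid midBot ≤
        Setoid.comap p α.toSetoid := by
      refine sup_le (map_le_iff.2 ?_) (map_le_iff.2 ?_)
      · rintro (x | x) (y | y) h <;> (obtain rfl : x = y := h; exact Setoid.refl' _ _)
      · rintro (x | x) (y | y) h <;> exact h
    rintro (x | x) (y | y) hxy <;> exact h hxy
  · set E := Setoid.map (PartitionMonoid.one n).toSetoid topMid ⊔ Setoid.map α.toSetoid midBot with hE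
    have h1 : ∀ x, E (topBot x) (midBot x) := by
      rintro (x | x)
      · exact (map_le_iff.1 (le_sup_left : _ ≤ E)) (x := Sum.inl x) (y := Sum.inr x) rfl
      · exact E.refl _
    intro x y h
    exact E.trans (h1 x) (E.trans ((map_le_iff.1 (le_sup_right : _ ≤ E)) h) (E.symm (h1 y)))

instance (n : ℕ) : Monoid (PartitionMonoid n) where
  mul := PartitionMonoid.mul
  one := PartitionMonoid.one n
  mul_assoc := PartitionMonoid.mul_assoc'
  one_mul := PartitionMonoid.one_mul'
  mul_one := PartitionMonoid.mul_one'

/-- `α.Rel x y` says that `x` and `y` lie in the same block of `α`. -/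
def PartitionMonoid.Rel (α : PartitionMonoid n) (x y : Fin n ⊕ Fin n) : Prop :=
  α.toSetoid x y

/-- The set of blocks of `α`. -/
def PartitionMonoid.blocks (α : PartitionMonoid n) : Set (Set (Fin n ⊕ Fin n)) :=
  α.toSetoid.classes

/-- The rank of `α`: the number of its transversal blocks, that is, of the blocks that meet both
rows. -/
noncomputable def PartitionMonoid.rank (α : PartitionMonoid n) : ℕ :=
  {b ∈ α.blocks | (∃ i, Sum.inl i ∈ b) ∧ ∃ j, Sum.inr j ∈ b}.ncard

/-- `α` is a Brauer diagram: every block has exactly two elements. -/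
def PartitionMonoid.IsBrauer (α : PartitionMonoid n) : Prop := ∀ b ∈ α.blocks, b.ncard = 2

theorem isBrauer_iff (α : PartitionMonoid n) : α.IsBrauer ↔
    ∃ p : Fin n ⊕ Fin n → Fin n ⊕ Fin n, ∀ x, p x ≠ x ∧ ∀ y, α.Rel x y ↔ y = x ∨ y = p x := by
  constructor
  · intro h
    have h2 : ∀ x, ∃ z, z ≠ x ∧ ∀ y, α.Rel x y ↔ y = x ∨ y = z := by
      intro x
      have hx := h {y | α.Rel y x} (Setoid.mem_classes α.toSetoid x)
      obtain ⟨u, v, huv, hs⟩ := Set.ncard_eq_two.1 hx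
      have hmem : ∀ y, α.Rel x y ↔ y = u ∨ y = v := by
        intro y
        have : y ∈ {y | α.Rel y x} ↔ y ∈ ({u, v} : Set _) := by rw [hs]
        exact ⟨fun hxy => this.1 (Setoid.symm' α.toSetoid hxy), fun hxy => Setoid.symm' α.toSetoid (this.2 hxy)⟩
      rcases (hmem x).1 (Setoid.refl' α.toSetoid x) with rfl | rfl
      · exact ⟨v, huv.symm, hmem⟩
      · exact ⟨u, huv, fun y => (hmem y).trans or_comm⟩
    choose p hp using h2
    exact ⟨p, hp⟩
  · rintro ⟨p, hp⟩ b ⟨x, rfl⟩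
    have : {y | α.Rel y x} = {x, p x} := by
      ext y
      exact ⟨fun h => ((hp x).2 y).1 (Setoid.symm' α.toSetoid h),
        fun h => Setoid.symm' α.toSetoid (((hp x).2 y).2 h)⟩
    change Set.ncard {y | α.Rel y x} = 2
    rw [this, Set.ncard_pair (hp x).1.symm]

theorem partner_invol {α : PartitionMonoid n} {p : Fin n ⊕ Fin n → Fin n ⊕ Fin n}
    (hp : ∀ x, p x ≠ x ∧ ∀ y, α.Rel x y ↔ y = x ∨ y = p x) (x : Fin n ⊕ Fin n) :
    p (p x) = x := by
  have h1 : α.Rel x (p x) := ((hp x).2 _).2 (Or.inr rfl)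
  rcases ((hp (p x)).2 x).1 (Setoid.symm' α.toSetoid h1) with h | h
  · exact absurd h.symm (hp x).1
  · exact h.symm

theorem isBrauer_one : (1 : PartitionMonoid n).IsBrauer := by
  refine (isBrauer_iff _).2 ⟨Sum.swap, ?_⟩
  rintro (x | x)
  · refine ⟨Sum.inr_ne_inl, ?_⟩
    rintro (y | y)
    · change x = y ↔ _
      simp [eq_comm]
    · change x = y ↔ _
      simp [eq_comm]
  · refine ⟨Sum.inl_ne_inr, ?_⟩
    rintro (y | y)
    · change x = y ↔ _
      simp [eq_comm]
    · change x = y ↔ _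
      simp [eq_comm]

theorem isBrauer_mul {α β : PartitionMonoid n} (hα : α.IsBrauer) (hβ : β.IsBrauer) :
    (α * β).IsBrauer := by
  obtain ⟨p, hp⟩ := (isBrauer_iff α).1 hα
  obtain ⟨q, hq⟩ := (isBrauer_iff β).1 hβ
  have hpi := partner_invol hp
  have hqi := partner_invol hq
  let a' : Fin n ⊕ (Fin n ⊕ Fin n) → Fin n ⊕ (Fin n ⊕ Fin n) :=
    Sum.elim (fun i => topMid (p (Sum.inl i)))
      (Sum.elim (fun i => topMid (p (Sum.inr i))) (fun i => Sum.inr (Sum.inr i)))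
  let b' : Fin n ⊕ (Fin n ⊕ Fin n) → Fin n ⊕ (Fin n ⊕ Fin n) :=
    Sum.elim Sum.inl (fun z => midBot (q z))
  have a_tm : ∀ z, a' (topMid z) = topMid (p z) := by rintro (z | z) <;> rfl
  have b_mb : ∀ z, b' (midBot z) = midBot (q z) := fun z => rfl
  have ha' : Function.Involutive a' := by
    rintro (x | x | x)
    · change a' (topMid (p (Sum.inl x))) = _
      rw [a_tm, hpi]; rfl
    · change a' (topMid (p (Sum.inr x))) = _
      rw [a_tm, hpi]; rfl
    · rfl
  have hb' : Function.Involutive b' := by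
    rintro (x | x)
    · rfl
    · change b' (midBot (q x)) = _
      rw [b_mb, hqi]; rfl
  let a : Equiv.Perm _ := ha'.toPerm
  let b : Equiv.Perm _ := hb'.toPerm
  have ha : a * a = 1 := Equiv.ext ha'
  have hb : b * b = 1 := Equiv.ext hb'
  have a_fix_tm : ∀ z, a (topMid z) ≠ topMid z := fun z h =>
    (hp z).1 (topMid_injective ((a_tm z).symm.trans h))
  have b_fix_mb : ∀ z, b (midBot z) ≠ midBot z := fun z h =>
    (hq z).1 (midBot_injective h)
  set E : Setoid (Fin n ⊕ (Fin n ⊕ Fin n)) := Setoid.map α.toSetoid topMid ⊔ Setoid.map β.toSetoid midBot with hEdef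
  have hEa : ∀ x, E x (a x) := by
    have h : ∀ z, E (topMid z) (a (topMid z)) := by
      intro z
      have := map_le_iff.1 (le_sup_left : _ ≤ E) (((hp z).2 (p z)).2 (Or.inr rfl))
      change E (topMid z) (a' (topMid z))
      rw [a_tm]
      exact this
    rintro (x | x | x)
    · exact h (Sum.inl x)
    · exact h (Sum.inr x)
    · exact E.refl _
  have hEb : ∀ x, E x (b x) := by
    rintro (x | x)
    · exact E.refl _
    · exact map_le_iff.1 (le_sup_right : _ ≤ E) (((hq x).2 (q x)).2 (Or.inr rfl))
  have hE : ∀ T : Setoid (Fin n ⊕ (Fin n ⊕ Fin n)),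
      (∀ x, T x (a x)) → (∀ x, T x (b x)) → E ≤ T := by
    intro T hTa hTb
    refine sup_le (map_le_iff.2 ?_) (map_le_iff.2 ?_)
    · intro x y hxy
      rcases ((hp x).2 y).1 hxy with rfl | rfl
      · exact T.refl _
      · have := hTa (topMid x)
        change T (topMid x) (a' (topMid x)) at this
        rw [a_tm] at this
        exact this
    · intro x y hxy
      rcases ((hq x).2 y).1 hxy with rfl | rfl
      · exact T.refl _
      · exact hTb (midBot x)
  have hab : ∀ x, ¬ (a x = x ∧ b x = x) := by
    rintro (x | x | x) ⟨h1, h2⟩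
    · exact a_fix_tm (Sum.inl x) h1
    · exact a_fix_tm (Sum.inr x) h1
    · exact b_fix_mb (Sum.inr x) h2
  have houter : ∀ x, (a x = x ∨ b x = x) ↔ ∃ z, x = topBot z := by
    rintro (x | x | x)
    · exact ⟨fun _ => ⟨Sum.inl x, rfl⟩, fun _ => Or.inr rfl⟩
    · constructor
      · rintro (h | h)
        · exact absurd h (a_fix_tm (Sum.inr x))
        · exact absurd h (b_fix_mb (Sum.inl x))
      · rintro ⟨z | z, h⟩ <;> simp [topBot] at h
    · exact ⟨fun _ => ⟨Sum.inr x, rfl⟩, fun _ => Or.inl rfl⟩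
  have main : ∀ x : Fin n ⊕ Fin n, ∃ z, z ≠ topBot x ∧ (a z = z ∨ b z = z) ∧ E (topBot x) z ∧
      ∀ w, E (topBot x) w → (a w = w ∨ b w = w) → w = topBot x ∨ w = z := by
    rintro (x | x)
    · exact dihedral_orbit a b ha hb E hEa hEb hE hab _ rfl
    · obtain ⟨z, h1, h2, h3, h4⟩ := dihedral_orbit b a hb ha E hEb hEa
        (fun T h1 h2 => hE T h2 h1) (fun x h => hab x h.symm) (topBot (Sum.inr x)) rfl
      exact ⟨z, h1, h2.symm, h3, fun w hw hw' => h4 w hw hw'.symm⟩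
  rw [isBrauer_iff]
  have fin : ∀ x, ∃ z, z ≠ x ∧ ∀ y, (α * β).Rel x y ↔ y = x ∨ y = z := by
    intro x
    obtain ⟨z, h1, h2, h3, h4⟩ := main x
    obtain ⟨z, rfl⟩ := (houter z).1 h2
    refine ⟨z, fun h => h1 (by rw [h]), fun y => ?_⟩
    change E (topBot x) (topBot y) ↔ _
    constructor
    · intro h
      rcases h4 _ h ((houter _).2 ⟨y, rfl⟩) with h | h
      · exact Or.inl (topBot_injective h)
      · exact Or.inr (topBot_injective h)
    · rintro (rfl | rfl)
      · exact E.refl _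
      · exact h3
  choose r hr using fin
  exact ⟨r, hr⟩

/-- The Brauer monoid `B_n`, as a submonoid of the partition monoid. -/
def brauerMonoid (n : ℕ) : Submonoid (PartitionMonoid n) where
  carrier := {α | α.IsBrauer}
  mul_mem' := isBrauer_mul
  one_mem' := isBrauer_one

/-- `J_r(B_n)`, the set of all elements of rank `r` of the Brauer monoid. -/
def brauerJ (n r : ℕ) : Set (brauerMonoid n) := {α | (α : PartitionMonoid n).rank = r}

/-! ### Green's relations and Graham–Houghton graphs -/

/-- Green's relation `R` on a monoid: `u R v` if and only if `uM = vM`. -/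
def greenR (M : Type*) [Monoid M] : Setoid M := Setoid.ker fun u => Set.range fun s : M => u * s

/-- Green's relation `L` on a monoid: `u L v` if and only if `Mu = Mv`. -/
def greenL (M : Type*) [Monoid M] : Setoid M := Setoid.ker fun u => Set.range fun s : M => s * u

/-- The set of `R`-classes of a monoid that meet the subset `J` (for a `J`-class: those contained
in it), each represented by its intersection with `J`. -/
abbrev RClasses {M : Type*} [Monoid M] (J : Set M) : Type _ :=
  Quotient ((greenR M).comap ((↑) : J → M))

/-- The set of `L`-classes of a monoid that meet the subset `J` (for a `J`-class: those contained
in it), each represented by its intersection with `J`. -/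
abbrev LClasses {M : Type*} [Monoid M] (J : Set M) : Type _ :=
  Quotient ((greenL M).comap ((↑) : J → M))

/-- The (undirected) Graham–Houghton graph of a `J`-class `J`: the bipartite graph whose two parts
are the sets of `R`-classes and of `L`-classes in `J`, where an `R`-class and an `L`-class are
adjacent if and only if their intersection contains an idempotent. -/
def grahamHoughtonGraph {M : Type*} [Monoid M] (J : Set M) :
    SimpleGraph (RClasses J ⊕ LClasses J) :=
  SimpleGraph.fromRel fun v w =>
    ∃ e : J, IsIdempotentElem (e : M) ∧
      v = Sum.inl (Quotient.mk ((greenR M).comap ((↑) : J → M)) e) ∧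
      w = Sum.inr (Quotient.mk ((greenL M).comap ((↑) : J → M)) e)

/-! ### Pfaffian orientations -/

/-- An orientation of a simple graph: every edge receives exactly one of its two directions;
`D.Arc u v` says that there is an edge between `u` and `v`, directed from `u` to `v`. -/
structure GraphOrientation {V : Type*} (G : SimpleGraph V) where
  /-- The arcs of the orientation. -/
  Arc : V → V → Prop
  adj_of_arc : ∀ {u v}, Arc u v → G.Adj u v
  xor_arc : ∀ {u v}, G.Adj u v → Xor (Arc u v) (Arc v u)

namespace GraphOrientation

variable {V : Type*} {G : SimpleGraph V}

open Classical in
/-- The number of edges of the walk `c` that are directed in the direction of traversal. -/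
noncomputable def forwardCount (D : GraphOrientation G) {u v : V} (c : G.Walk u v) : ℕ :=
  c.darts.countP fun d => decide (D.Arc d.fst d.snd)

/-- A circuit is oddly oriented if for either choice of direction of traversal, the number of its
edges directed in the direction of traversal is odd. -/
def OddlyOriented (D : GraphOrientation G) {u : V} (c : G.Walk u u) : Prop :=
  Odd (D.forwardCount c) ∧ Odd (D.forwardCount c.reverse)

end GraphOrientation

/-- A circuit is central if the graph obtained by deleting its vertices has a perfect matching. -/
def IsCentral {V : Type*} {G : SimpleGraph V} {u : V} (c : G.Walk u u) : Prop :=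
  ∃ M : (G.induce {v | v ∉ c.support}).Subgraph, M.IsPerfectMatching

/-- An orientation is Pfaffian if every even central circuit is oddly oriented. -/
def GraphOrientation.IsPfaffian {V : Type*} {G : SimpleGraph V} (D : GraphOrientation G) : Prop :=
  ∀ (u : V) (c : G.Walk u u), c.IsCycle → Even c.length → IsCentral c → D.OddlyOriented c

end DiagramMonoid

/-!
The involution of `B_n` that swaps the two rows pairs the `R`-class of each `α` with the `L`-class
of `α*`, and `α α*` is an idempotent in both, so this pairing is a perfect matching of the
Graham–Houghton graph. Three rank `n - 2` projections `p₀, p₁, p₂` (the hooks on the two-element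
subsets of a three-element set) satisfy `pᵢ pⱼ pᵢ = pᵢ`, so that each `pᵢ pⱼ` is an idempotent
`R`-related to `pᵢ` and `L`-related to `pⱼ`: their classes span a `K₃,₃` whose vertex set is a
union of edges of the matching. Write `a₀, a₁, a₂` and `b₀, b₁, b₂` for the two sides of this
`K₃,₃`. Every `4`-circuit `a₀ bⱼ a₁ bₖ` is central, as what remains of the `K₃,₃` is a single edge.
Say that `bⱼ` is coherent if both of its edges to `a₀` and `a₁` point towards `bⱼ` or both point
away from it. The circuit is oddly oriented precisely when exactly one of `bⱼ` and `bₖ` is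
coherent, and this cannot happen for all three pairs.
-/

namespace DiagramMonoid

section Pfaffian

open SimpleGraph

variable {V : Type*} {G : SimpleGraph V}

theorem isCentral_of_isMatching {u : V} {c : G.Walk u u} {M : G.Subgraph} (hM : M.IsMatching)
    (hverts : M.verts = {v | v ∉ c.support}) : IsCentral c := by
  refine ⟨M.comap (Embedding.induce _).toHom, Subgraph.isPerfectMatching_iff.2 ?_⟩
  rintro ⟨v, hv⟩
  obtain ⟨w, hvw, hw⟩ := hM (hverts ▸ hv)
  have hwc : w ∉ c.support := hverts.subset (M.edge_vert hvw.symm)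
  exact ⟨⟨w, hwc⟩, ⟨hvw.adj_sub, hvw⟩, fun x hx => Subtype.ext (hw x hx.2)⟩

/-- The closed walk `u, v, w, x, u`. -/
def squareWalk {u v w x : V} (huv : G.Adj u v) (hvw : G.Adj v w) (hwx : G.Adj w x)
    (hxu : G.Adj x u) : G.Walk u u :=
  .cons huv (.cons hvw (.cons hwx (.cons hxu .nil)))

section Square

variable {u v w x : V} (huv : G.Adj u v) (hvw : G.Adj v w) (hwx : G.Adj w x) (hxu : G.Adj x u)

theorem isCycle_squareWalk (huw : u ≠ w) (hvx : v ≠ x) :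
    (squareWalk huv hvw hwx hxu).IsCycle := by
  have := huv.ne
  have := hvw.ne
  have := hwx.ne
  have := hxu.ne
  rw [squareWalk, Walk.cons_isCycle_iff]
  constructor
  · simp only [Walk.isPath_def, Walk.support_cons, Walk.support_nil, List.nodup_cons, List.mem_cons,
      List.not_mem_nil, or_false, not_or, not_false_eq_true, List.nodup_nil, and_true]
    grind
  · simp only [Walk.edges_cons, Walk.edges_nil, List.mem_cons, Sym2.eq, Sym2.rel_iff',
      Prod.mk.injEq, Prod.swap_prod_mk, List.not_mem_nil, or_false]
    grind

theorem mem_support_squareWalk {y : V} :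
    y ∈ (squareWalk huv hvw hwx hxu).support ↔ y = u ∨ y = v ∨ y = w ∨ y = x := by
  simp only [squareWalk, Walk.support_cons, Walk.support_nil, List.mem_cons, List.not_mem_nil,
    or_false]
  grind

theorem odd_forwardCount_squareWalk_iff (D : GraphOrientation G) :
    Odd (D.forwardCount (squareWalk huv hvw hwx hxu)) ↔
      ¬ ((D.Arc u v ↔ D.Arc w v) ↔ (D.Arc u x ↔ D.Arc w x)) := by
  have hv := D.xor_arc hvw
  have hx := D.xor_arc hxu
  have hodd (p : Prop) [Decidable p] : Odd (if p then 1 else 0) ↔ p := by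
    split_ifs with hp <;> simp [hp]
  simp only [squareWalk, GraphOrientation.forwardCount, Walk.darts_cons, Walk.darts_nil,
    List.countP_cons, List.countP_nil, decide_eq_true_eq, Nat.odd_add, ← Nat.not_odd_iff_even, hodd,
    Nat.not_odd_zero, false_iff, not_not]
  rw [xor_iff_iff_not] at hv hx
  tauto

theorem GraphOrientation.IsPfaffian.not_arc_iff_arc {D : GraphOrientation G} (hD : D.IsPfaffian)
    (huw : u ≠ w) (hvx : v ≠ x) (hc : IsCentral (squareWalk huv hvw hwx hxu)) :
    ¬ ((D.Arc u v ↔ D.Arc w v) ↔ (D.Arc u x ↔ D.Arc w x)) :=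
  (odd_forwardCount_squareWalk_iff huv hvw hwx hxu D).1
    (hD _ _ (isCycle_squareWalk huv hvw hwx hxu huw hvx) ⟨2, rfl⟩ hc).1

end Square

section CompleteBipartite

variable (φ : Copy (completeBipartiteGraph (Fin 3) (Fin 3)) G)

theorem adj_inl_inr (i j : Fin 3) : G.Adj (φ (Sum.inl i)) (φ (Sum.inr j)) :=
  φ.toHom.map_adj (by simp)

variable {M : G.Subgraph} (hM : M.IsMatching) (hverts : M.verts = (Set.range φ)ᶜ)

include hM hverts in
theorem isCentral_squareWalk_of_copy {j k : Fin 3} (hjk : j ≠ k) :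
    IsCentral (squareWalk (adj_inl_inr φ 0 j) (adj_inl_inr φ 1 j).symm (adj_inl_inr φ 1 k)
      (adj_inl_inr φ 0 k).symm) := by
  obtain ⟨l, hl⟩ : ∃ l, ∀ m, m = l ↔ m ≠ j ∧ m ≠ k := by revert j k; decide
  have hφ : Function.Injective φ := φ.injective
  have hedge : (G.subgraphOfAdj (adj_inl_inr φ 2 l)).verts = φ '' {Sum.inl 2, Sum.inr l} := by
    rw [subgraphOfAdj_verts, Set.image_pair]
  have hsquare : {v | v ∈ (squareWalk (adj_inl_inr φ 0 j) (adj_inl_inr φ 1 j).symm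
      (adj_inl_inr φ 1 k) (adj_inl_inr φ 0 k).symm).support} =
      φ '' {Sum.inl 2, Sum.inr l}ᶜ := by
    have hcompl : ({Sum.inl 2, Sum.inr l}ᶜ : Set (Fin 3 ⊕ Fin 3)) =
        {Sum.inl 0, Sum.inr j, Sum.inl 1, Sum.inr k} := by
      ext (m | m)
      · fin_cases m <;> simp
      · simp [hl, imp_iff_not_or]
    simp only [hcompl, Set.image_insert_eq, Set.image_singleton]
    ext v
    exact mem_support_squareWalk _ _ _ _
  refine isCentral_of_isMatching (hM.sup (.subgraphOfAdj (adj_inl_inr φ 2 l)) ?_) ?_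
  · rw [hM.support_eq_verts, (Subgraph.IsMatching.subgraphOfAdj _).support_eq_verts, hverts, hedge]
    exact disjoint_compl_left_iff.2 (Set.image_subset_range _ _)
  · rw [Subgraph.verts_sup, hverts, hedge, ← Set.compl_ofPred, hsquare,
      Set.image_compl_eq_range_sdiff_image hφ, Set.compl_sdiff, Set.union_comm]

include hM hverts in
theorem not_isPfaffian_of_copy_completeBipartiteGraph (D : GraphOrientation G) :
    ¬ D.IsPfaffian := by
  intro hD
  have hsquare : ∀ j k : Fin 3, j ≠ k →
      ¬ ((D.Arc (φ (Sum.inl 0)) (φ (Sum.inr j)) ↔ D.Arc (φ (Sum.inl 1)) (φ (Sum.inr j))) ↔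
        (D.Arc (φ (Sum.inl 0)) (φ (Sum.inr k)) ↔ D.Arc (φ (Sum.inl 1)) (φ (Sum.inr k)))) :=
    fun j k hjk => hD.not_arc_iff_arc _ _ _ _ (φ.injective.ne (by simp))
      (φ.injective.ne (by simpa using hjk)) (isCentral_squareWalk_of_copy φ hM hverts hjk)
  have h₀₁ := hsquare 0 1 (by decide)
  have h₀₂ := hsquare 0 2 (by decide)
  have h₁₂ := hsquare 1 2 (by decide)
  tauto

end CompleteBipartite

section Bipartite

variable {A B : Type*} {G : SimpleGraph (A ⊕ B)} (e : A ≃ B)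
  (he : ∀ a, G.Adj (Sum.inl a) (Sum.inr (e a)))

include he in
theorem exists_isMatching_verts_eq_preimage (S : Set A) :
    ∃ M : G.Subgraph, M.verts = Sum.elim id e.symm ⁻¹' S ∧ M.IsMatching := by
  set π : A ⊕ B → A := Sum.elim id e.symm
  let M : G.Subgraph :=
    { verts := π ⁻¹' S
      Adj := fun x y => G.Adj x y ∧ π x ∈ S ∧ π x = π y
      adj_sub := And.left
      edge_vert := fun h => h.2.1
      symm := ⟨fun _ _ h => ⟨h.1.symm, h.2.2 ▸ h.2.1, h.2.2.symm⟩⟩ }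
  refine ⟨M, rfl, ?_⟩
  rintro (a | b) hS
  · refine ⟨Sum.inr (e a), ⟨he a, hS, (e.symm_apply_apply a).symm⟩, ?_⟩
    rintro (a' | b) ⟨hadj, -, rfl⟩
    · exact absurd rfl hadj.ne
    · exact congrArg Sum.inr (e.apply_symm_apply b).symm
  · refine ⟨Sum.inl (e.symm b), ⟨?_, hS, rfl⟩, ?_⟩
    · simpa using (he (e.symm b)).symm
    · rintro (a | b') ⟨hadj, -, h⟩
      · exact congrArg Sum.inl h.symm
      · exact absurd (congrArg Sum.inr (e.symm.injective h)) hadj.ne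

include he in
theorem not_isPfaffian_of_forall_adj_of_injective {a : Fin 3 → A} (ha : Function.Injective a)
    (hadj : ∀ i j, G.Adj (Sum.inl (a i)) (Sum.inr (e (a j)))) (D : GraphOrientation G) :
    ¬ D.IsPfaffian := by
  let φ : Copy (completeBipartiteGraph (Fin 3) (Fin 3)) G :=
    { toHom :=
        { toFun := Sum.map a (e ∘ a)
          map_rel' := by
            rintro (i | i) (j | j) h <;> simp_all [(hadj _ _).symm] }
      injective' := ha.sumMap (e.injective.comp ha) }
  obtain ⟨M, hverts, hM⟩ := exists_isMatching_verts_eq_preimage e he (Set.range a)ᶜ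
  refine not_isPfaffian_of_copy_completeBipartiteGraph φ hM ?_ D
  have hrange : Set.range φ = Sum.elim id e.symm ⁻¹' Set.range a := by
    ext (b | b) <;> simp [φ, Equiv.eq_symm_apply]
  rw [hverts, hrange, Set.preimage_compl]

end Bipartite

end Pfaffian

section Green

variable {M : Type*} [Monoid M] {u v : M}

theorem greenR_iff : greenR M u v ↔ (∃ s, u = v * s) ∧ ∃ s, v = u * s := by
  refine ⟨fun h => ⟨?_, ?_⟩, ?_⟩
  · obtain ⟨s, hs⟩ := (Set.ext_iff.1 h u).1 ⟨1, mul_one u⟩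
    exact ⟨s, hs.symm⟩
  · obtain ⟨s, hs⟩ := (Set.ext_iff.1 h v).2 ⟨1, mul_one v⟩
    exact ⟨s, hs.symm⟩
  · rintro ⟨⟨s, hs⟩, t, ht⟩
    refine Set.Subset.antisymm ?_ ?_
    · rintro _ ⟨m, rfl⟩
      exact ⟨s * m, by simp only [← mul_assoc, ← hs]⟩
    · rintro _ ⟨m, rfl⟩
      exact ⟨t * m, by simp only [← mul_assoc, ← ht]⟩

theorem greenR_coe {S : Submonoid M} {u v : S} (h : greenR S u v) : greenR M u v :=
  greenR_iff.2 ((greenR_iff.1 h).imp (fun ⟨s, hs⟩ => ⟨s, congrArg _ hs⟩)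
    fun ⟨s, hs⟩ => ⟨s, congrArg _ hs⟩)

theorem greenL_iff : greenL M u v ↔ (∃ s, u = s * v) ∧ ∃ s, v = s * u := by
  refine ⟨fun h => ⟨?_, ?_⟩, ?_⟩
  · obtain ⟨s, hs⟩ := (Set.ext_iff.1 h u).1 ⟨1, one_mul u⟩
    exact ⟨s, hs.symm⟩
  · obtain ⟨s, hs⟩ := (Set.ext_iff.1 h v).2 ⟨1, one_mul v⟩
    exact ⟨s, hs.symm⟩
  · rintro ⟨⟨s, hs⟩, t, ht⟩
    refine Set.Subset.antisymm ?_ ?_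
    · rintro _ ⟨m, rfl⟩
      exact ⟨m * s, by simp only [mul_assoc, ← hs]⟩
    · rintro _ ⟨m, rfl⟩
      exact ⟨m * t, by simp only [mul_assoc, ← ht]⟩

theorem greenL_star_star [StarMul M] : greenL M (star u) (star v) ↔ greenR M u v := by
  have heq (a b : M) : (∃ s, star a = s * star b) ↔ ∃ s, a = b * s := by
    refine star_involutive.surjective.exists.trans (exists_congr fun s => ?_)
    rw [← star_mul, star_inj]
  rw [greenL_iff, greenR_iff, heq, heq]

/-- A regular `*`-monoid: an involution `star` reversing products for which `star a` is a
(generalised) inverse of `a`. -/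
class RegularStarMul (M : Type*) [Mul M] extends StarMul M where
  mul_star_mul_self : ∀ a : M, a * star a * a = a

end Green

section GrahamHoughton

variable {M : Type*} [Monoid M] {J : Set M}

/-- The `R`-class of an element of `J`, as a point of `RClasses J`. -/
def rClass (u : J) : RClasses J := Quotient.mk _ u

/-- The `L`-class of an element of `J`, as a point of `LClasses J`. -/
def lClass (u : J) : LClasses J := Quotient.mk _ u

theorem rClass_eq_rClass {u v : J} : rClass u = rClass v ↔ greenR M u v :=
  Quotient.eq

theorem lClass_eq_lClass {u v : J} : lClass u = lClass v ↔ greenL M u v :=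
  Quotient.eq

theorem grahamHoughtonGraph_adj_of_isIdempotentElem {u v : J} {e : M} (heJ : e ∈ J)
    (he : IsIdempotentElem e) (hu : greenR M e u) (hv : greenL M e v) :
    (grahamHoughtonGraph J).Adj (Sum.inl (rClass u)) (Sum.inr (lClass v)) :=
  (SimpleGraph.fromRel_adj ..).2 ⟨Sum.inl_ne_inr, Or.inl ⟨⟨e, heJ⟩, he,
    congrArg Sum.inl (rClass_eq_rClass.2 ((greenR M).symm hu)),
    congrArg Sum.inr (lClass_eq_lClass.2 ((greenL M).symm hv))⟩⟩

section Star

/-- The bijection between `R`-classes and `L`-classes in `J` induced by the involution. -/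
def starClassEquiv [StarMul M] (hstar : ∀ u ∈ J, star u ∈ J) : RClasses J ≃ LClasses J :=
  Quotient.congr
    (Equiv.Perm.star.subtypeEquiv fun u => ⟨hstar u, fun h => star_star u ▸ hstar _ h⟩)
    fun _ _ => greenL_star_star.symm

theorem starClassEquiv_rClass [StarMul M] (hstar : ∀ u ∈ J, star u ∈ J) (u : J) :
    starClassEquiv hstar (rClass u) = lClass ⟨star (u : M), hstar u u.2⟩ :=
  rfl

variable [RegularStarMul M]

theorem isIdempotentElem_mul_star_self (a : M) : IsIdempotentElem (a * star a) := by
  rw [IsIdempotentElem, ← mul_assoc, RegularStarMul.mul_star_mul_self]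

variable (hstar : ∀ u ∈ J, star u ∈ J) (hR : ∀ u ∈ J, ∀ v, greenR M v u → v ∈ J)

include hstar hR

theorem grahamHoughtonGraph_adj_starClassEquiv (C : RClasses J) :
    (grahamHoughtonGraph J).Adj (Sum.inl C) (Sum.inr (starClassEquiv hstar C)) := by
  induction C using Quotient.inductionOn with | _ u
  have hreg := RegularStarMul.mul_star_mul_self (u : M)
  have hu : greenR M (u * star (u : M)) u := greenR_iff.2 ⟨⟨_, rfl⟩, _, hreg.symm⟩
  refine grahamHoughtonGraph_adj_of_isIdempotentElem (v := ⟨star (u : M), hstar u u.2⟩)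
    (hR u u.2 _ hu) (isIdempotentElem_mul_star_self _) hu ?_
  simpa only [star_mul, star_star] using greenL_star_star.2 hu

theorem not_isPfaffian_grahamHoughtonGraph {p : Fin 3 → J} (hp : ∀ i, IsSelfAdjoint (p i : M))
    (hmul : ∀ i j, (p i * p j * p i : M) = p i)
    (hinj : ∀ i j, greenR M (p i) (p j) → i = j) (D : GraphOrientation (grahamHoughtonGraph J)) :
    ¬ D.IsPfaffian := by
  refine not_isPfaffian_of_forall_adj_of_injective (starClassEquiv hstar)
    (grahamHoughtonGraph_adj_starClassEquiv hstar hR) (a := fun i => rClass (p i))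
    (fun i j h => hinj i j (rClass_eq_rClass.1 h)) (fun i j => ?_) D
  have hpi : greenR M (p i * p j) (p i) := greenR_iff.2 ⟨⟨_, rfl⟩, _, (hmul i j).symm⟩
  have hpj : greenL M (p i * p j) (p j) :=
    greenL_iff.2 ⟨⟨_, rfl⟩, p j, by rw [← mul_assoc, hmul]⟩
  have hidem : IsIdempotentElem (p i * p j : M) := by
    rw [IsIdempotentElem, ← mul_assoc, hmul]
  have hstar_pj : lClass ⟨star (p j : M), hstar _ (p j).2⟩ = lClass (p j) :=
    congrArg lClass (Subtype.ext (hp j).star_eq)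
  rw [starClassEquiv_rClass, hstar_pj]
  exact grahamHoughtonGraph_adj_of_isIdempotentElem (hR _ (p i).2 _ hpi) hidem hpi hpj

end Star

end GrahamHoughton

variable {n : ℕ}

namespace PartitionMonoid

variable {α β : PartitionMonoid n} {i j k : Fin n} {x y z : Fin n ⊕ Fin n}

section Rel

theorem Rel.refl (α : PartitionMonoid n) (x : Fin n ⊕ Fin n) : α.Rel x x := α.toSetoid.refl' x

theorem Rel.symm (h : α.Rel x y) : α.Rel y x := α.toSetoid.symm' h

theorem Rel.trans (h : α.Rel x y) (h' : α.Rel y z) : α.Rel x z := α.toSetoid.trans' h h'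

theorem ext_rel (h : ∀ x y, α.Rel x y ↔ β.Rel x y) : α = β :=
  PartitionMonoid.ext (Setoid.ext h)

end Rel

section Mul

/-- The partition of three rows obtained by stacking `α` above `β`, so that the product `α * β` is
its restriction to the two outer rows. -/
def stack (α β : PartitionMonoid n) : Setoid (Fin n ⊕ (Fin n ⊕ Fin n)) :=
  Setoid.map α.toSetoid topMid ⊔ Setoid.map β.toSetoid midBot

theorem stack_topMid (h : α.Rel x y) : stack α β (topMid x) (topMid y) :=
  map_le_iff.1 (le_sup_left : _ ≤ stack α β) h

theorem stack_midBot (h : β.Rel x y) : stack α β (midBot x) (midBot y) :=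
  map_le_iff.1 (le_sup_right : _ ≤ stack α β) h

theorem stack_le {T : Setoid (Fin n ⊕ (Fin n ⊕ Fin n))}
    (hα : ∀ x y, α.Rel x y → T (topMid x) (topMid y))
    (hβ : ∀ x y, β.Rel x y → T (midBot x) (midBot y)) : stack α β ≤ T :=
  sup_le (map_le_iff.2 fun {_ _} h => hα _ _ h) (map_le_iff.2 fun {_ _} h => hβ _ _ h)

theorem mul_rel_inl_inl (h : α.Rel (Sum.inl i) (Sum.inl j)) :
    (α * β).Rel (Sum.inl i) (Sum.inl j) :=
  stack_topMid h

theorem mul_rel_inr_inr (h : β.Rel (Sum.inr i) (Sum.inr j)) :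
    (α * β).Rel (Sum.inr i) (Sum.inr j) :=
  stack_midBot h

theorem mul_rel_inl_inr (hα : α.Rel (Sum.inl i) (Sum.inr k)) (hβ : β.Rel (Sum.inl k) (Sum.inr j)) :
    (α * β).Rel (Sum.inl i) (Sum.inr j) :=
  (stack α β).trans' (stack_topMid hα) (stack_midBot hβ)

theorem mul_rel_of_zigzag {l m : Fin n} (hij : α.Rel (Sum.inl i) (Sum.inr j))
    (hjk : β.Rel (Sum.inl j) (Sum.inl k)) (hkl : α.Rel (Sum.inr k) (Sum.inr l))
    (hlm : β.Rel (Sum.inl l) (Sum.inr m)) : (α * β).Rel (Sum.inl i) (Sum.inr m) :=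
  have htrans := @Setoid.trans' _ (stack α β)
  htrans (htrans (stack_topMid hij) (stack_midBot hjk))
    (htrans (stack_topMid hkl) (stack_midBot hlm))

end Mul

section Star

instance : InvolutiveStar (PartitionMonoid n) where
  star α := ⟨Setoid.comap Sum.swap α.toSetoid⟩
  star_involutive α := ext_rel fun x y => by
    change α.Rel x.swap.swap y.swap.swap ↔ _
    rw [Sum.swap_swap, Sum.swap_swap]

theorem star_rel : (star α).Rel x y ↔ α.Rel x.swap y.swap := Iff.rfl

theorem rel_of_star_mul_rel (h : (star (α * β)).Rel x y) : (star β * star α).Rel x y := by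
  let reverse : Fin n ⊕ (Fin n ⊕ Fin n) → Fin n ⊕ (Fin n ⊕ Fin n) :=
    Sum.elim (Sum.inr ∘ Sum.inr) (Sum.elim (Sum.inr ∘ Sum.inl) Sum.inl)
  have htopMid (z) : reverse (topMid z) = midBot z.swap := by cases z <;> rfl
  have hmidBot (z) : reverse (midBot z) = topMid z.swap := by cases z <;> rfl
  have htopBot (z : Fin n ⊕ Fin n) : reverse (topBot z.swap) = topBot z := by cases z <;> rfl
  have hle : stack α β ≤ Setoid.comap reverse (stack (star β) (star α)) := by
    refine stack_le (fun x y hxy => ?_) (fun x y hxy => ?_)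
    · rw [Setoid.comap_rel, htopMid, htopMid]
      exact stack_midBot (by simpa only [star_rel, Sum.swap_swap] using hxy)
    · rw [Setoid.comap_rel, hmidBot, hmidBot]
      exact stack_topMid (by simpa only [star_rel, Sum.swap_swap] using hxy)
  have := hle h
  rwa [Setoid.comap_rel, htopBot, htopBot] at this

theorem rel_of_mul_star_mul_self_rel (h : (α * star α * α).Rel x y) : α.Rel x y := by
  have hfold : stack α (star α) ≤
      Setoid.comap (Sum.elim Sum.inl (Sum.elim Sum.inr Sum.inl)) α.toSetoid :=
    stack_le (by rintro (_ | _) (_ | _) h <;> exact h) (by rintro (_ | _) (_ | _) h <;> exact h)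
  have hfold' : stack (α * star α) α ≤
      Setoid.comap (Sum.elim Sum.inl (Sum.elim Sum.inl Sum.inr)) α.toSetoid :=
    stack_le (by rintro (_ | _) (_ | _) h <;> exact hfold h)
      (by rintro (_ | _) (_ | _) h <;> exact h)
  rcases x with x | x <;> rcases y with y | y <;> exact hfold' h

theorem Rel.mul_star_mul_self (h : α.Rel x y) : (α * star α * α).Rel x y := by
  have htransversal {i j : Fin n} (h : α.Rel (Sum.inl i) (Sum.inr j)) :
      (α * star α * α).Rel (Sum.inl i) (Sum.inr j) :=
    mul_rel_inl_inr (mul_rel_inl_inr h (star_rel.2 h.symm)) h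
  rcases x with x | x <;> rcases y with y | y
  · exact mul_rel_inl_inl (mul_rel_inl_inl h)
  · exact htransversal h
  · exact (htransversal h.symm).symm
  · exact mul_rel_inr_inr h

instance : RegularStarMul (PartitionMonoid n) where
  star_mul α β := ext_rel fun x y => by
    refine ⟨rel_of_star_mul_rel, fun h => ?_⟩
    rw [← star_star (star β * star α), star_rel] at h
    simpa only [star_star, Sum.swap_swap, star_rel] using rel_of_star_mul_rel h
  mul_star_mul_self _ := ext_rel fun _ _ =>
    ⟨rel_of_mul_star_mul_self_rel, Rel.mul_star_mul_self⟩

end Star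

section Rank

/-- The domain of `α`: the points of the upper row that lie in a transversal block. -/
def dom (α : PartitionMonoid n) : Set (Fin n) := {i | ∃ j, α.Rel (Sum.inl i) (Sum.inr j)}

/-- The block of `α` that contains the point `i` of the upper row. -/
def upperBlock (α : PartitionMonoid n) (i : Fin n) : Set (Fin n ⊕ Fin n) :=
  {x | α.Rel x (Sum.inl i)}

theorem upperBlock_eq_iff : α.upperBlock i = α.upperBlock j ↔ α.Rel (Sum.inl i) (Sum.inl j) :=
  ⟨fun h => h.subset (Rel.refl α _), fun h => Set.ext fun _ => ⟨(·.trans h), (·.trans h.symm)⟩⟩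

theorem rank_eq_ncard_image_dom (α : PartitionMonoid n) :
    α.rank = (α.upperBlock '' α.dom).ncard := by
  refine congrArg Set.ncard (Set.ext fun b => ⟨?_, ?_⟩)
  · rintro ⟨⟨x, rfl⟩, ⟨i, hi⟩, j, hj⟩
    have hij : α.Rel (Sum.inl i) (Sum.inr j) := Rel.trans hi (Rel.symm hj)
    exact ⟨i, ⟨j, hij⟩, Set.ext fun y => ⟨(Rel.trans · hi), (Rel.trans · (Rel.symm hi))⟩⟩
  · rintro ⟨i, ⟨j, hij⟩, rfl⟩
    exact ⟨⟨_, rfl⟩, ⟨i, Rel.refl α _⟩, j, hij.symm⟩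

theorem dom_mul_subset (α β : PartitionMonoid n) : dom (α * β) ⊆ dom α := by
  rintro i ⟨j, hij⟩
  by_contra hi
  let inUpperBlock : Fin n ⊕ (Fin n ⊕ Fin n) → Prop :=
    Sum.elim (fun k => α.Rel (Sum.inl i) (Sum.inl k)) fun _ => False
  have htopMid (z) : inUpperBlock (topMid z) ↔ α.Rel (Sum.inl i) z := by
    rcases z with k | k
    · rfl
    · exact ⟨False.elim, fun h => hi ⟨k, h⟩⟩
  have hle : stack α β ≤ Setoid.ker inUpperBlock :=
    stack_le (fun x y h => propext (by
      rw [htopMid, htopMid]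
      exact ⟨(·.trans h), (·.trans h.symm)⟩)) fun _ _ _ => rfl
  exact (hle hij).mp (Rel.refl α _)

theorem rank_mul_le_left (α β : PartitionMonoid n) : (α * β).rank ≤ α.rank := by
  have hfactor : (α * β).upperBlock =
      (fun b => ⋃ i ∈ Sum.inl ⁻¹' b, (α * β).upperBlock i) ∘ α.upperBlock := by
    ext i x
    simp only [Function.comp_apply, Set.mem_iUnion, Set.mem_preimage]
    refine ⟨fun h => ⟨i, Rel.refl α _, h⟩, ?_⟩
    rintro ⟨k, hk, hx⟩
    exact Rel.trans (α := α * β) hx (mul_rel_inl_inl hk)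
  calc (α * β).rank = ((α * β).upperBlock '' (α * β).dom).ncard := rank_eq_ncard_image_dom _
    _ ≤ ((α * β).upperBlock '' α.dom).ncard :=
      Set.ncard_le_ncard (Set.image_mono (dom_mul_subset α β))
    _ ≤ (α.upperBlock '' α.dom).ncard := by
      rw [hfactor, Set.image_comp]
      exact Set.ncard_image_le
    _ = α.rank := (rank_eq_ncard_image_dom α).symm

theorem rank_le_rank_star (α : PartitionMonoid n) : α.rank ≤ (star α).rank := by
  refine Set.ncard_le_ncard_of_injOn (Set.preimage Sum.swap) ?_
    (Set.preimage_injective.2 Sum.swap_rightInverse.surjective).injOn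
  rintro _ ⟨⟨x, rfl⟩, ⟨i, hi⟩, j, hj⟩
  refine ⟨⟨x.swap, Set.ext fun y => ?_⟩, ⟨j, hj⟩, i, hi⟩
  change α.Rel y.swap x ↔ α.Rel y.swap x.swap.swap
  rw [Sum.swap_swap]

theorem rank_star (α : PartitionMonoid n) : (star α).rank = α.rank :=
  ((rank_le_rank_star _).trans_eq (congrArg rank (star_star α))).antisymm (rank_le_rank_star α)

end Rank

section Green

theorem rel_inl_inl_iff_of_greenR (h : greenR _ α β) :
    α.Rel (Sum.inl i) (Sum.inl j) ↔ β.Rel (Sum.inl i) (Sum.inl j) := by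
  obtain ⟨⟨s, hs⟩, t, ht⟩ := greenR_iff.1 h
  exact ⟨fun hα => ht ▸ mul_rel_inl_inl hα, fun hβ => hs ▸ mul_rel_inl_inl hβ⟩

theorem rank_eq_of_greenR (h : greenR _ α β) : α.rank = β.rank := by
  obtain ⟨⟨s, hs⟩, t, ht⟩ := greenR_iff.1 h
  exact le_antisymm (hs ▸ rank_mul_le_left β s) (ht ▸ rank_mul_le_left α t)

end Green

section IsBrauer

theorem IsBrauer.star (hα : α.IsBrauer) : (star α).IsBrauer := by
  obtain ⟨p, hp⟩ := (isBrauer_iff α).1 hα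
  refine (isBrauer_iff _).2 ⟨fun x => (p x.swap).swap, fun x => ⟨fun h => ?_, fun y => ?_⟩⟩
  · exact (hp x.swap).1 ((Equiv.eq_symm_apply (Equiv.sumComm _ _)).1 h.symm).symm
  · rw [star_rel, (hp _).2, Sum.swap_leftInverse.injective.eq_iff]
    exact or_congr_right (Equiv.eq_symm_apply (Equiv.sumComm _ _)).symm

theorem IsBrauer.eq_of_rel_imp_rel (hα : α.IsBrauer) (hβ : β.IsBrauer)
    (h : ∀ x y, α.Rel x y → β.Rel x y) : α = β := by
  obtain ⟨p, hp⟩ := (isBrauer_iff α).1 hα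
  obtain ⟨q, hq⟩ := (isBrauer_iff β).1 hβ
  have hpq (x) : p x = q x :=
    (((hq x).2 _).1 (h _ _ (((hp x).2 _).2 (Or.inr rfl)))).resolve_left (hp x).1
  refine ext_rel fun x y => ?_
  rw [(hp x).2, (hq x).2, hpq]

end IsBrauer

end PartitionMonoid

section BrauerMonoid

variable {r : ℕ} {α β : brauerMonoid n}

instance : RegularStarMul (brauerMonoid n) where
  star α := ⟨star α, α.2.star⟩
  star_involutive α := Subtype.ext (star_star (α : PartitionMonoid n))
  star_mul α β := Subtype.ext (star_mul (α : PartitionMonoid n) β)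
  mul_star_mul_self α := Subtype.ext (RegularStarMul.mul_star_mul_self (α : PartitionMonoid n))

theorem star_mem_brauerJ (hα : α ∈ brauerJ n r) : star α ∈ brauerJ n r :=
  (PartitionMonoid.rank_star _).trans hα

theorem mem_brauerJ_of_greenR (hα : α ∈ brauerJ n r) (h : greenR _ β α) : β ∈ brauerJ n r :=
  (PartitionMonoid.rank_eq_of_greenR (greenR_coe h)).trans hα

end BrauerMonoid

section Hook

open PartitionMonoid
open scoped Finset

/-- Labels of the blocks of `hook s`: one for the points of `s` in the upper row, one for the
points of `s` in the lower row, and one for each `k ∉ s`. -/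
def hookLabel (s : Finset (Fin n)) : Fin n ⊕ Fin n → Bool ⊕ Fin n :=
  Sum.elim (fun k => if k ∈ s then Sum.inl false else Sum.inr k)
    (fun k => if k ∈ s then Sum.inl true else Sum.inr k)

/-- The hook on `s`: the diagram whose blocks are `s`, its copy `s'` in the lower row, and
`{k, k'}` for each `k ∉ s`. For a two-element set `s` this is a Brauer diagram of rank `n - 2`. -/
def hook (s : Finset (Fin n)) : PartitionMonoid n where
  toSetoid := Setoid.ker (hookLabel s)

variable {s t : Finset (Fin n)} {i j : Fin n}

theorem hook_rel {x y : Fin n ⊕ Fin n} : (hook s).Rel x y ↔ hookLabel s x = hookLabel s y :=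
  Iff.rfl

theorem hook_rel_inl_inl : (hook s).Rel (Sum.inl i) (Sum.inl j) ↔ i = j ∨ i ∈ s ∧ j ∈ s := by
  simp only [hook_rel, hookLabel, Sum.elim_inl]
  grind

theorem hook_rel_inr_inr : (hook s).Rel (Sum.inr i) (Sum.inr j) ↔ i = j ∨ i ∈ s ∧ j ∈ s := by
  simp only [hook_rel, hookLabel, Sum.elim_inr]
  grind

theorem hook_rel_inl_inr : (hook s).Rel (Sum.inl i) (Sum.inr j) ↔ i = j ∧ i ∉ s := by
  simp only [hook_rel, hookLabel, Sum.elim_inl, Sum.elim_inr]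
  grind

theorem hook_rel_inr_inl : (hook s).Rel (Sum.inr i) (Sum.inl j) ↔ i = j ∧ i ∉ s := by
  simp only [hook_rel, hookLabel, Sum.elim_inl, Sum.elim_inr]
  grind

theorem isSelfAdjoint_hook (s : Finset (Fin n)) : IsSelfAdjoint (hook s) :=
  ext_rel fun x y => by
    rcases x with i | i <;> rcases y with j | j <;>
      simp only [star_rel, Sum.swap_inl, Sum.swap_inr, hook_rel_inl_inl, hook_rel_inr_inr,
        hook_rel_inl_inr, hook_rel_inr_inl]

theorem isBrauer_hook (hs : #s = 2) : (hook s).IsBrauer := by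
  obtain ⟨a, b, hab, rfl⟩ := Finset.card_eq_two.1 hs
  refine (isBrauer_iff _).2 ⟨Sum.elim
    (fun k => if k = a then Sum.inl b else if k = b then Sum.inl a else Sum.inr k)
    (fun k => if k = a then Sum.inr b else if k = b then Sum.inr a else Sum.inl k), ?_⟩
  rintro (i | i)
  · refine ⟨by grind, ?_⟩
    rintro (j | j)
    · simp only [hook_rel_inl_inl]
      grind
    · simp only [hook_rel_inl_inr]
      grind
  · refine ⟨by grind, ?_⟩
    rintro (j | j)
    · simp only [hook_rel_inr_inl]
      grind
    · simp only [hook_rel_inr_inr]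
      grind

theorem dom_hook (s : Finset (Fin n)) : dom (hook s) = (sᶜ : Finset (Fin n)) := by
  ext i
  simp [dom, hook_rel_inl_inr]

theorem injOn_upperBlock_hook (s : Finset (Fin n)) :
    Set.InjOn (upperBlock (hook s)) (sᶜ : Finset (Fin n)) := fun _ hi _ _ h =>
  (hook_rel_inl_inl.1 (upperBlock_eq_iff.1 h)).resolve_right fun h =>
    Finset.mem_compl.1 hi h.1

theorem rank_hook (s : Finset (Fin n)) : (hook s).rank = n - #s := by
  rw [rank_eq_ncard_image_dom, dom_hook, (injOn_upperBlock_hook s).ncard_image,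
    Set.ncard_coe_finset, Finset.card_compl, Fintype.card_fin]

theorem eq_of_greenR_hook (hs : 1 < #s) (ht : 1 < #t)
    (h : greenR _ (hook s) (hook t)) : s = t := by
  have hsubset {s t : Finset (Fin n)} (hs : 1 < #s) (h : greenR _ (hook s) (hook t)) :
      s ⊆ t := by
    intro a ha
    obtain ⟨b, hb, hba⟩ := Finset.exists_mem_ne hs a
    have := (rel_inl_inl_iff_of_greenR h).1 (hook_rel_inl_inl.2 (.inr ⟨ha, hb⟩))
    exact ((hook_rel_inl_inl.1 this).resolve_left hba.symm).1
  exact (hsubset hs h).antisymm (hsubset ht ((greenR _).symm h))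

theorem hook_mul_hook_mul_hook_rel (hcard : #s = #t) (hst : (s ∩ t).Nonempty) (hi : i ∉ s) :
    (hook s * hook t * hook s).Rel (Sum.inl i) (Sum.inr i) := by
  have hs : (hook s).Rel (Sum.inl i) (Sum.inr i) := hook_rel_inl_inr.2 ⟨rfl, hi⟩
  by_cases hit : i ∈ t
  · obtain ⟨a, ha⟩ := hst
    obtain ⟨b, hb⟩ : (s \ t).Nonempty := by
      rw [← Finset.card_pos, Finset.card_sdiff_comm hcard, Finset.card_pos]
      exact ⟨i, Finset.mem_sdiff.2 ⟨hit, hi⟩⟩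
    rw [Finset.mem_inter] at ha
    rw [Finset.mem_sdiff] at hb
    have hb' : (hook s * hook t).Rel (Sum.inl i) (Sum.inr b) :=
      mul_rel_of_zigzag hs (hook_rel_inl_inl.2 (.inr ⟨hit, ha.2⟩))
        (hook_rel_inr_inr.2 (.inr ⟨ha.1, hb.1⟩)) (hook_rel_inl_inr.2 ⟨rfl, hb.2⟩)
    exact mul_rel_of_zigzag hb' (hook_rel_inl_inl.2 (.inr ⟨hb.1, ha.1⟩))
      (mul_rel_inr_inr (hook_rel_inr_inr.2 (.inr ⟨ha.2, hit⟩))) hs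
  · exact mul_rel_inl_inr (mul_rel_inl_inr hs (hook_rel_inl_inr.2 ⟨rfl, hit⟩)) hs

theorem hook_mul_hook_mul_hook (hs : #s = 2) (ht : #t = 2) (hst : (s ∩ t).Nonempty) :
    hook s * hook t * hook s = hook s := by
  have htransversal {i : Fin n} := hook_mul_hook_mul_hook_rel (i := i) (hs.trans ht.symm) hst
  refine ((isBrauer_hook hs).eq_of_rel_imp_rel (isBrauer_mul
    (isBrauer_mul (isBrauer_hook hs) (isBrauer_hook ht)) (isBrauer_hook hs)) fun x y h => ?_).symm
  rcases x with i | i <;> rcases y with j | j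
  · exact mul_rel_inl_inl (mul_rel_inl_inl h)
  · obtain ⟨rfl, hi⟩ := hook_rel_inl_inr.1 h
    exact htransversal hi
  · obtain ⟨rfl, hi⟩ := hook_rel_inr_inl.1 h
    exact (htransversal hi).symm
  · exact mul_rel_inr_inr h

/-- The hook on a two-element set, as an element of the `J`-class of rank `n - 2` of the Brauer
monoid. -/
def brauerHook (s : Finset (Fin n)) (hs : #s = 2) : brauerJ n (n - 2) :=
  ⟨⟨hook s, isBrauer_hook hs⟩, (rank_hook s).trans (by rw [hs])⟩

end Hook

end DiagramMonoid

open DiagramMonoid in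
theorem mainTheorem10 (n : ℕ) (hn : 3 ≤ n) :
    ¬ ∃ D : DiagramMonoid.GraphOrientation
        (DiagramMonoid.grahamHoughtonGraph (DiagramMonoid.brauerJ n (n - 2))),
      D.IsPfaffian := by
  rintro ⟨D, hD⟩
  let s (i : Fin 3) : Finset (Fin n) := ({i}ᶜ : Finset (Fin 3)).map (Fin.castLEEmb hn)
  have hs (i) : (s i).card = 2 := by simp [s, Finset.card_compl]
  have hinter (i j) : (s i ∩ s j).Nonempty := by
    rw [← Finset.map_inter, Finset.map_nonempty]
    revert i j
    decide
  have hinj : Function.Injective s :=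
    (Finset.map_injective _).comp (compl_injective.comp Finset.singleton_injective)
  exact not_isPfaffian_grahamHoughtonGraph (p := fun i => brauerHook (s i) (hs i))
    (fun _ => star_mem_brauerJ) (fun _ hu _ => mem_brauerJ_of_greenR hu)
    (fun i => Subtype.ext (isSelfAdjoint_hook (s i)))
    (fun i j => Subtype.ext (hook_mul_hook_mul_hook (hs i) (hs j) (hinter i j)))
    (fun i j h => hinj (eq_of_greenR_hook (by simp [hs]) (by simp [hs]) (greenR_coe h))) D hD
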